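/- Let $l^1$ and $l^\infty$ be the complex Banach spaces of absolutely summable, respectively bounded, complex sequences, and identify $l^\infty$ with the dual of $l^1$ through $\langle y,x\rangle=\sum_n y_nx_n$. For a bounded linear operator $T$ on a complex Banach space $X$ and $x\in X$, let $J_T(x)$ be the set of all $y\in X$ for which there exist a strictly increasing sequence $(k_n)$ of natural numbers and a sequence $(x_n)$ in $X$ such that $x_n\to x$ and $T^{k_n}x_n\to y$ in norm. The operator $T$ is called $J$-class if $J_T(x)=X$ for some $x\in X\setminus\{0\}$. A bounded linear operator $T$ on $l^\infty$ is called an adjoint operator if $T=S^*$ for some bounded linear operator $S$ on $l^1$. Let $T_1,T_2$ be bounded linear operators on $l^\infty$ which commute, are both adjoint operators, and are both $J$-class. Then the product $T_1T_2$ is $J$-class. -/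

import Mathlib

open Filter Topology
open scoped ENNReal

/-- The complex Banach space `l^1` of absolutely summable complex sequences. -/
abbrev SeqL1 : Type := lp (fun _ : ℕ => ℂ) 1

/-- The complex Banach space `l^∞` of bounded complex sequences, with the sup-norm. -/
abbrev SeqLInf : Type := lp (fun _ : ℕ => ℂ) ∞

/-- The `J`-set of `x` under `T`: all `y` for which there are a strictly increasing sequence
`(k n)` of natural numbers and a sequence `(u n)` with `u n → x` and `T ^ (k n) (u n) → y`. -/
def JSet {X : Type*} [NormedAddCommGroup X] [NormedSpace ℂ X] (T : X →L[ℂ] X) (x : X) : Set X :=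
  {y | ∃ k : ℕ → ℕ, StrictMono k ∧ ∃ u : ℕ → X,
    Tendsto u atTop (𝓝 x) ∧ Tendsto (fun n => (T ^ k n) (u n)) atTop (𝓝 y)}

/-- `T` is a `J`-class operator if `J_T(x)` is the whole space for some non-zero vector `x`. -/
def IsJClass {X : Type*} [NormedAddCommGroup X] [NormedSpace ℂ X] (T : X →L[ℂ] X) : Prop :=
  ∃ x : X, x ≠ 0 ∧ JSet T x = Set.univ

/-- The canonical (bilinear) identification of `l^∞` with the dual of `l^1`:
`y` is sent to the functional `x ↦ ∑ n, y n * x n`. -/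
noncomputable def lInfToDual : SeqLInf →L[ℂ] StrongDual ℂ SeqL1 :=
  lp.dualPairing ∞ 1 (fun _ : ℕ => ContinuousLinearMap.mul ℂ ℂ) (K := 1)
    (fun _ => by simp)

theorem lInfToDual_apply (y : SeqLInf) (x : SeqL1) :
    lInfToDual y x = ∑' n, y n * x n :=
  rfl

/-- `T` on `l^∞` is the (Banach space) adjoint `S*` of the operator `S` on `l^1`, where `l^∞` is
identified with the dual of `l^1`: the functional of `T y` is the functional of `y` after `S`. -/
def IsAdjointOf (T : SeqLInf →L[ℂ] SeqLInf) (S : SeqL1 →L[ℂ] SeqL1) : Prop :=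
  ∀ y : SeqLInf, lInfToDual (T y) = (lInfToDual y).comp S

/-- `T` on `l^∞` is an adjoint operator: `T = S*` for some bounded operator `S` on `l^1`. -/
def IsAdjointOperator (T : SeqLInf →L[ℂ] SeqLInf) : Prop :=
  ∃ S : SeqL1 →L[ℂ] SeqL1, IsAdjointOf T S

/-! Write `T = S*`. If `T` is `J`-class, then `S` expands: some `N` works for all `f`, with `‖S^k f‖
≥ 2‖f‖` for some `1 ≤ k ≤ N` (`IsAdjointOf.exists_two_mul_norm_le`, through the Schur property of
`l^1`). Hence `S^n` is eventually bounded below by any constant, and by Hahn-Banach `T^n` is onto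
with arbitrarily small preimages. This property passes to commuting products. An injective such `T`
would force `u n → 0` whenever `T^(k n) (u n) → 0`, contradicting `0 ∈ J_T(x)` with `x ≠ 0`; so `T`
kills some `z ≠ 0`. A kernel vector of `T₁` is killed by `T₁T₂ = T₂T₁`, and adding it to small
preimages shows that its `J`-set is everything. -/

theorem SeqL1.hasSum_norm (f : SeqL1) : HasSum (fun i => ‖f i‖) ‖f‖ := by
  simpa using lp.hasSum_norm (p := 1) (by simp) f

theorem SeqLInf.summable_mul (y : SeqLInf) (f : SeqL1) : Summable fun i => y i * f i := by
  refine Summable.of_norm_bounded (f.hasSum_norm.summable.mul_left ‖y‖) fun i => ?_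
  rw [norm_mul]
  gcongr
  exact lp.norm_apply_le_norm (by simp) y i

theorem norm_lInfToDual_apply_le (y : SeqLInf) (f : SeqL1) :
    ‖lInfToDual y f‖ ≤ ‖y‖ * ‖f‖ := by
  rw [lInfToDual_apply]
  refine tsum_of_norm_bounded (f.hasSum_norm.mul_left ‖y‖) fun i => ?_
  rw [norm_mul]
  gcongr
  exact lp.norm_apply_le_norm (by simp) y i

theorem lInfToDual_apply_single (y : SeqLInf) (i : ℕ) (a : ℂ) :
    lInfToDual y (lp.single 1 i a) = y i * a := by
  rw [lInfToDual_apply, tsum_eq_single i]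
  · simp
  · intro j hj
    simp [Pi.single_eq_of_ne hj]

theorem lInfToDual_single_apply (f : SeqL1) (i : ℕ) (a : ℂ) :
    lInfToDual (lp.single ∞ i a) f = a * f i := by
  rw [lInfToDual_apply, tsum_eq_single i]
  · simp
  · intro j hj
    simp [Pi.single_eq_of_ne hj]

theorem lInfToDual_injective : Function.Injective lInfToDual := by
  intro y z h
  ext i
  simpa [lInfToDual_apply_single] using DFunLike.congr_fun h (lp.single 1 i 1)

/-- Every functional on `l^1` is represented by an element of `l^∞` of at most the same norm. -/
theorem exists_lInfToDual_eq (φ : StrongDual ℂ SeqL1) :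
    ∃ y : SeqLInf, lInfToDual y = φ ∧ ‖y‖ ≤ ‖φ‖ := by
  have hb (i : ℕ) : ‖φ (lp.single 1 i 1)‖ ≤ ‖φ‖ := by
    simpa [lp.norm_single] using φ.le_opNorm (lp.single 1 i 1)
  let y : SeqLInf := ⟨fun i => φ (lp.single 1 i 1), memℓp_infty ⟨‖φ‖, by
    rintro _ ⟨i, rfl⟩
    exact hb i⟩⟩
  refine ⟨y, ?_, lp.norm_le_of_forall_le (norm_nonneg _) hb⟩
  ext f
  have hf := φ.hasSum (lp.hasSum_single (p := 1) (by simp) f)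
  rw [← hf.tsum_eq, lInfToDual_apply]
  congr 1
  ext i
  have : (lp.single 1 i (f i) : SeqL1) = f i • lp.single 1 i 1 := by
    rw [← lp.single_smul]; simp
  rw [this, map_smul, smul_eq_mul, mul_comm]

/-- The element of `l^∞` given by a sequence in the closed unit disc. -/
def seqLInfOfClosedBall (y : ℕ → Metric.closedBall (0 : ℂ) 1) : SeqLInf :=
  ⟨fun i => y i, memℓp_infty ⟨1, by
    rintro _ ⟨i, rfl⟩
    exact mem_closedBall_zero_iff.1 (y i).2⟩⟩

theorem continuous_lInfToDual_seqLInfOfClosedBall (f : SeqL1) :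
    Continuous fun y => lInfToDual (seqLInfOfClosedBall y) f := by
  simp only [lInfToDual_apply]
  refine continuous_tsum (u := fun i => ‖f i‖) (fun i => ?_) f.hasSum_norm.summable fun i y => ?_
  · exact (continuous_subtype_val.comp (continuous_apply i)).mul continuous_const
  · rw [norm_mul]
    exact mul_le_of_le_one_left (norm_nonneg _) (mem_closedBall_zero_iff.1 (y i).2)

/-! ### Schur property of `l^1` -/

/-- Off `I` the pairing recovers `|f i|` exactly; each coordinate in `I` costs at most `2|f i|`. -/
theorem norm_le_norm_lInfToDual_add (f : SeqL1) (y : SeqLInf) (I : Finset ℕ)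
    (hI : ∀ i ∈ I, ‖y i‖ ≤ 1) (hy : ∀ i ∉ I, y i * f i = ‖f i‖) :
    ‖f‖ ≤ ‖lInfToDual y f‖ + 2 * ∑ i ∈ I, ‖f i‖ := by
  have h1 : HasSum (fun i => (‖f i‖ : ℂ)) ‖f‖ := Complex.hasSum_ofReal.2 f.hasSum_norm
  have h2 := h1.sub (y.summable_mul f).hasSum
  rw [← lInfToDual_apply] at h2
  have h3 : (‖f‖ : ℂ) - lInfToDual y f = ∑ i ∈ I, ((‖f i‖ : ℂ) - y i * f i) :=
    h2.unique (hasSum_sum_of_ne_finset_zero fun i hi => by rw [hy i hi, sub_self])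
  have h4 : ‖(‖f‖ : ℂ) - lInfToDual y f‖ ≤ 2 * ∑ i ∈ I, ‖f i‖ := by
    rw [h3, Finset.mul_sum]
    refine norm_sum_le_of_le _ fun i hi => ?_
    calc ‖(‖f i‖ : ℂ) - y i * f i‖ ≤ ‖(‖f i‖ : ℂ)‖ + ‖y i‖ * ‖f i‖ := by
          rw [← norm_mul]; exact norm_sub_le _ _
      _ ≤ ‖f i‖ + 1 * ‖f i‖ := by
          rw [Complex.norm_real, norm_norm]
          gcongr
          exact hI i hi
      _ = 2 * ‖f i‖ := by ring
  have h5 := norm_sub_norm_le (‖f‖ : ℂ) (lInfToDual y f)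
  rw [Complex.norm_real, norm_norm] at h5
  linarith

theorem exists_norm_le_one_mul_eq_norm (a : ℂ) : ∃ w : ℂ, ‖w‖ ≤ 1 ∧ w * a = ‖a‖ := by
  rcases eq_or_ne a 0 with rfl | ha
  · exact ⟨0, by simp, by simp⟩
  · have ha' : (‖a‖ : ℂ) ≠ 0 := by simpa using ha
    refine ⟨‖a‖ / a, by simp [ha], by field_simp⟩

/-- The Schur property of `l^1`: weakly null sequences are norm null. -/
theorem tendsto_norm_zero_of_weakly_null (f : ℕ → SeqL1)
    (hf : ∀ y : SeqLInf, Tendsto (fun j => lInfToDual y (f j)) atTop (𝓝 0)) :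
    Tendsto (fun j => ‖f j‖) atTop (𝓝 0) := by
  rw [Metric.tendsto_atTop]
  intro ε hε
  -- Baire category on the compact product of discs: some `F n` contains a basic open set, which
  -- restricts only the finitely many coordinates in `I`.
  let F (n : ℕ) : Set (ℕ → Metric.closedBall (0 : ℂ) 1) :=
    ⋂ j ≥ n, {y | ‖lInfToDual (seqLInfOfClosedBall y) (f j)‖ ≤ ε / 4}
  have hF (n : ℕ) : IsClosed (F n) := isClosed_biInter fun j _ =>
    isClosed_le (continuous_lInfToDual_seqLInfOfClosedBall _).norm continuous_const
  have hU : ⋃ n, F n = Set.univ := by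
    refine Set.eq_univ_of_forall fun y => ?_
    obtain ⟨n, hn⟩ := Metric.tendsto_atTop.1 (hf (seqLInfOfClosedBall y)) (ε / 4) (by positivity)
    refine Set.mem_iUnion.2 ⟨n, Set.mem_iInter₂.2 fun j hj => ?_⟩
    simpa using (hn j hj).le
  have : Nonempty (Metric.closedBall (0 : ℂ) 1) := ⟨⟨0, by simp⟩⟩
  have : CompactSpace (Metric.closedBall (0 : ℂ) 1) :=
    isCompact_iff_compactSpace.1 (isCompact_closedBall _ _)
  obtain ⟨n, y₀, hy₀⟩ := nonempty_interior_of_iUnion_of_closed hF hU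
  obtain ⟨I, u, hu, hIu⟩ := isOpen_pi_iff.1 isOpen_interior y₀ hy₀
  have hsum : Tendsto (fun j => ∑ i ∈ I, ‖f j i‖) atTop (𝓝 0) := by
    rw [← Finset.sum_const_zero (s := I)]
    refine tendsto_finsetSum _ fun i _ => ?_
    simpa [lInfToDual_single_apply] using (hf (lp.single ∞ i 1)).norm
  obtain ⟨m, hm⟩ := Metric.tendsto_atTop.1 hsum (ε / 4) (by positivity)
  refine ⟨max n m, fun j hj => ?_⟩
  choose w hw1 hw using fun i => exists_norm_le_one_mul_eq_norm (f j i)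
  classical
  let y (i : ℕ) : Metric.closedBall (0 : ℂ) 1 :=
    if i ∈ I then y₀ i else ⟨w i, by simpa using hw1 i⟩
  have hyF : y ∈ F n := by
    refine interior_subset (hIu fun i hi => ?_)
    have hi' : i ∈ I := hi
    simpa [y, hi'] using (hu i hi').2
  have h1 : ‖lInfToDual (seqLInfOfClosedBall y) (f j)‖ ≤ ε / 4 :=
    Set.mem_iInter₂.1 hyF j (le_trans (le_max_left _ _) hj)
  have h2 := norm_le_norm_lInfToDual_add (f j) (seqLInfOfClosedBall y) I
    (fun i _ => mem_closedBall_zero_iff.1 (y i).2)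
    (fun i hi => by
      have : seqLInfOfClosedBall y i = w i := by simp [seqLInfOfClosedBall, y, hi]
      rw [this, hw])
  have h3 := hm j (le_trans (le_max_right _ _) hj)
  rw [Real.dist_0_eq_abs] at h3 ⊢
  rw [abs_norm]
  have := (le_abs_self _).trans_lt h3
  linarith

theorem exists_frequently_le_norm_lInfToDual (f : ℕ → SeqL1) (hf : ∀ j, ‖f j‖ = 1) :
    ∃ (y : SeqLInf) (c : ℝ), 0 < c ∧ ∃ᶠ j in atTop, c ≤ ‖lInfToDual y (f j)‖ := by
  by_contra! h
  have := tendsto_norm_zero_of_weakly_null f fun y => by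
    rw [Metric.tendsto_nhds]
    intro ε hε
    simpa [not_frequently] using h y ε hε
  simp [hf] at this

/-! ### Expansion of the preadjoint -/

theorem IsAdjointOf.lInfToDual_pow {T : SeqLInf →L[ℂ] SeqLInf} {S : SeqL1 →L[ℂ] SeqL1}
    (h : IsAdjointOf T S) (n : ℕ) (y : SeqLInf) (f : SeqL1) :
    lInfToDual ((T ^ n) y) f = lInfToDual y ((S ^ n) f) := by
  induction n generalizing f with
  | zero => simp
  | succ n ih =>
    rw [pow_succ' T, pow_succ S, mul_apply_eq_comp, mul_apply_eq_comp, h,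
      ContinuousLinearMap.comp_apply, ih]

theorem IsAdjointOf.exists_two_mul_norm_le {T : SeqLInf →L[ℂ] SeqLInf} {S : SeqL1 →L[ℂ] SeqL1}
    (h : IsAdjointOf T S) {x : SeqLInf} (hx : JSet T x = Set.univ) :
    ∃ N : ℕ, ∀ f : SeqL1, ∃ k, 1 ≤ k ∧ k ≤ N ∧ 2 * ‖f‖ ≤ ‖(S ^ k) f‖ := by
  by_contra! H
  have H' (N : ℕ) : ∃ f : SeqL1, ‖f‖ = 1 ∧ ∀ k, 1 ≤ k → k ≤ N → ‖(S ^ k) f‖ ≤ 2 := by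
    -- With `N + 1` the range of `k` is nonempty, which forces `f ≠ 0`.
    obtain ⟨f, hf⟩ := H (N + 1)
    have hf0 : 0 < ‖f‖ := by
      have := (norm_nonneg _).trans_lt (hf 1 le_rfl (by omega))
      linarith
    refine ⟨((‖f‖⁻¹ : ℝ) : ℂ) • f, ?_, fun k hk hkN => ?_⟩
    · rw [norm_smul, Complex.norm_real, norm_inv, norm_norm, inv_mul_cancel₀ hf0.ne']
    · rw [map_smul, norm_smul, Complex.norm_real, norm_inv, norm_norm, inv_mul_le_iff₀ hf0,
        mul_comm]
      exact (hf k hk (by omega)).le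
  choose f hf1 hf using H'
  obtain ⟨y, c, hc, hy⟩ := exists_frequently_le_norm_lInfToDual f hf1
  -- Large enough that `M • y`, paired with `f j`, exceeds what `T^k u` with `‖u‖ < ‖x‖ + 1` can
  -- give, up to an error of 1.
  obtain ⟨M, hM⟩ := exists_nat_gt ((1 + (‖x‖ + 1) * 2) / c)
  rw [div_lt_iff₀ hc] at hM
  obtain ⟨k, hk, u, hu, hTu⟩ : (M : ℂ) • y ∈ JSet T x := hx ▸ Set.mem_univ _
  have e1 : ∀ᶠ n in atTop, ‖u n‖ < ‖x‖ + 1 := hu.norm.eventually_lt_const (by linarith)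
  have e2 : ∀ᶠ n in atTop, ‖(T ^ k n) (u n) - (M : ℂ) • y‖ < 1 :=
    (tendsto_iff_norm_sub_tendsto_zero.1 hTu).eventually_lt_const one_pos
  obtain ⟨n, h1, h2, hn⟩ := (e1.and (e2.and (eventually_ge_atTop 1))).exists
  have hkn : 1 ≤ k n := hn.trans hk.le_apply
  obtain ⟨j, hj, hkj⟩ := (hy.and_eventually (eventually_ge_atTop (k n))).exists
  have h3 : lInfToDual ((M : ℂ) • y) (f j)
      = lInfToDual (u n) ((S ^ k n) (f j))
        - lInfToDual ((T ^ k n) (u n) - (M : ℂ) • y) (f j) := by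
    rw [map_sub, sub_apply, h.lInfToDual_pow, sub_sub_cancel]
  have h4 : ‖lInfToDual (u n) ((S ^ k n) (f j))‖ ≤ (‖x‖ + 1) * 2 :=
    (norm_lInfToDual_apply_le _ _).trans (by gcongr; exact hf j _ hkn hkj)
  have h5 : ‖lInfToDual ((T ^ k n) (u n) - (M : ℂ) • y) (f j)‖ ≤ 1 * 1 :=
    (norm_lInfToDual_apply_le _ _).trans (by gcongr; exact (hf1 j).le)
  have h6 : ‖lInfToDual ((M : ℂ) • y) (f j)‖ = M * ‖lInfToDual y (f j)‖ := by
    rw [map_smul, smul_apply, norm_smul, Complex.norm_natCast]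
  have h7 := norm_sub_le (lInfToDual (u n) ((S ^ k n) (f j)))
    (lInfToDual ((T ^ k n) (u n) - (M : ℂ) • y) (f j))
  rw [← h3, h6] at h7
  have h8 : M * c ≤ M * ‖lInfToDual y (f j)‖ := by gcongr
  linarith

section Expansion

variable {X : Type*} [NormedAddCommGroup X] [NormedSpace ℂ X]

theorem eventually_mul_norm_le_pow {S : X →L[ℂ] X} {N : ℕ}
    (hS : ∀ f : X, ∃ k, 1 ≤ k ∧ k ≤ N ∧ 2 * ‖f‖ ≤ ‖(S ^ k) f‖) (M : ℝ) :
    ∀ᶠ n in atTop, ∀ f : X, M * ‖f‖ ≤ ‖(S ^ n) f‖ := by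
  set C : ℝ := max ‖S‖ 1 with hC
  have hC1 : 1 ≤ C := le_max_right _ _
  have hpow (m : ℕ) (g : X) : ‖(S ^ m) g‖ ≤ C ^ m * ‖g‖ := by
    refine ((S ^ m).le_opNorm g).trans ?_
    gcongr
    rcases m.eq_zero_or_pos with rfl | hm
    · exact (ContinuousLinearMap.norm_id_le (𝕜 := ℂ) (E := X)).trans_eq (pow_zero C).symm
    · exact (norm_pow_le' S hm).trans (by gcongr; exact le_max_left _ _)
  -- Chaining doubling steps overshoots `n` by at most `N`; coming back to `n` costs at most `C ^
  -- N`.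
  obtain ⟨i, hi⟩ := pow_unbounded_of_one_lt (M * C ^ N) (one_lt_two (α := ℝ))
  have key (n : ℕ) (f : X) : ∀ j ≤ n, ∃ k, j ≤ k ∧ k ≤ n + N ∧
      ∃ l : ℕ, k ≤ N * l ∧ 2 ^ l * ‖f‖ ≤ ‖(S ^ k) f‖ := by
    intro j
    induction j with
    | zero => exact fun _ => ⟨0, le_rfl, by omega, 0, by simp, by simp⟩
    | succ j ih =>
      intro hj
      obtain ⟨k, h1, h2, l, h3, h4⟩ := ih (by omega)
      by_cases hjk : j + 1 ≤ k
      · exact ⟨k, hjk, h2, l, h3, h4⟩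
      · obtain ⟨a, h5, h6, h7⟩ := hS ((S ^ k) f)
        refine ⟨a + k, by omega, by omega, l + 1, by rw [mul_add]; omega, ?_⟩
        rw [pow_add S, mul_apply_eq_comp, pow_succ]
        linarith
  filter_upwards [eventually_ge_atTop (N * i)] with n hn f
  obtain ⟨k, h1, h2, l, h3, h4⟩ := key n f n le_rfl
  have hil : i ≤ l := by
    obtain ⟨a, ha, haN, -⟩ := hS f
    exact Nat.le_of_mul_le_mul_left (hn.trans (h1.trans h3)) (ha.trans haN)
  have h5 : ‖(S ^ k) f‖ ≤ C ^ N * ‖(S ^ n) f‖ := by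
    obtain ⟨m, rfl⟩ := Nat.exists_eq_add_of_le' h1
    rw [pow_add, mul_apply_eq_comp]
    refine (hpow m _).trans ?_
    gcongr
    omega
  have h6 : (2 : ℝ) ^ i ≤ 2 ^ l := pow_le_pow_right₀ one_le_two hil
  have hCN : 0 < C ^ N := by positivity
  refine le_of_mul_le_mul_left ?_ hCN
  calc C ^ N * (M * ‖f‖) = M * C ^ N * ‖f‖ := by ring
    _ ≤ 2 ^ l * ‖f‖ := by gcongr; exact hi.le.trans h6
    _ ≤ _ := h4.trans h5

end Expansion

/-! ### Small preimages and kernel vectors -/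

/-- A functional dominated by `‖A ·‖` factors through `A`, with control of the norm. -/
theorem exists_dual_comp_eq {E F : Type*} [NormedAddCommGroup E] [NormedSpace ℂ E]
    [NormedAddCommGroup F] [NormedSpace ℂ F] (A : E →L[ℂ] F) (φ : StrongDual ℂ E) {C : ℝ}
    (hC : 0 ≤ C) (hA : ∀ f, ‖φ f‖ ≤ C * ‖A f‖) (hinj : Function.Injective A) :
    ∃ ψ : StrongDual ℂ F, ψ.comp A = φ ∧ ‖ψ‖ ≤ C := by
  let e := LinearEquiv.ofInjective A.toLinearMap hinj
  have he (f : E) : (e f : F) = A f := rfl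
  let g : StrongDual ℂ (LinearMap.range A.toLinearMap) :=
    (φ.toLinearMap.comp e.symm.toLinearMap).mkContinuous C fun z => by
      obtain ⟨f, rfl⟩ := e.surjective z
      simpa [← he] using hA f
  obtain ⟨ψ, hψ, hnorm⟩ := exists_extension_norm_eq _ g
  refine ⟨ψ, ?_, hnorm.trans_le (LinearMap.mkContinuous_norm_le _ hC _)⟩
  ext f
  rw [ContinuousLinearMap.comp_apply, ← he, hψ]
  simp [g]

/-- The powers of a `J`-class adjoint operator are eventually onto, with preimages as small as
desired. -/
theorem IsAdjointOperator.eventually_exists_preimage {T : SeqLInf →L[ℂ] SeqLInf}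
    (h : IsAdjointOperator T) (hJ : IsJClass T) {ε : ℝ} (hε : 0 < ε) :
    ∀ᶠ n in atTop, ∀ y, ∃ u, (T ^ n) u = y ∧ ‖u‖ ≤ ε * ‖y‖ := by
  obtain ⟨S, hS⟩ := h
  obtain ⟨x, -, hx⟩ := hJ
  obtain ⟨N, hN⟩ := hS.exists_two_mul_norm_le hx
  filter_upwards [eventually_mul_norm_le_pow hN ε⁻¹] with n hn y
  have hinj : Function.Injective (S ^ n) := by
    refine (injective_iff_map_eq_zero _).2 fun f hf => ?_
    have := hn f
    rw [hf, norm_zero] at this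
    exact norm_le_zero_iff.1 (nonpos_of_mul_nonpos_right this (inv_pos.2 hε))
  obtain ⟨ψ, hψ, hψn⟩ := exists_dual_comp_eq (S ^ n) (lInfToDual y) (C := ε * ‖y‖) (by positivity)
    (fun f => (norm_lInfToDual_apply_le y f).trans (by
      have := (inv_mul_le_iff₀ hε).1 (hn f)
      calc ‖y‖ * ‖f‖ ≤ ‖y‖ * (ε * ‖(S ^ n) f‖) := by gcongr
        _ = _ := by ring)) hinj
  obtain ⟨u, rfl, hun⟩ := exists_lInfToDual_eq ψ
  refine ⟨u, lInfToDual_injective ?_, hun.trans hψn⟩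
  ext f
  rw [hS.lInfToDual_pow, ← hψ, ContinuousLinearMap.comp_apply]

theorem IsAdjointOperator.exists_ne_zero_map_eq_zero {T : SeqLInf →L[ℂ] SeqLInf}
    (h : IsAdjointOperator T) (hJ : IsJClass T) : ∃ z, z ≠ 0 ∧ T z = 0 := by
  have hpre := h.eventually_exists_preimage hJ one_pos
  obtain ⟨x, hx0, hx⟩ := hJ
  by_contra! H
  have hinj : Function.Injective T :=
    (injective_iff_map_eq_zero _).2 fun z hz => by_contra fun hz0 => H z hz0 hz
  obtain ⟨k, hk, u, hu, hTu⟩ : (0 : SeqLInf) ∈ JSet T x := hx ▸ Set.mem_univ _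
  have hTu' : Tendsto (fun n => ‖(T ^ k n) (u n)‖) atTop (𝓝 0) := by
    simpa only [norm_zero] using hTu.norm
  refine hx0 (tendsto_nhds_unique hu (squeeze_zero_norm' ?_ hTu'))
  filter_upwards [hk.tendsto_atTop.eventually hpre] with n hn
  obtain ⟨v, hv, hvn⟩ := hn ((T ^ k n) (u n))
  have : Function.Injective (T ^ k n) := by
    simpa only [← ContinuousLinearMap.coe_coe, ContinuousLinearMap.toLinearMap_pow,
      Module.End.coe_pow] using hinj.iterate (k n)
  rwa [this hv, one_mul] at hvn

theorem jSet_eq_univ_of_map_eq_zero {X : Type*} [NormedAddCommGroup X] [NormedSpace ℂ X]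
    {T : X →L[ℂ] X}
    (hT : ∀ ε > 0, ∀ᶠ n in atTop, ∀ y, ∃ u, (T ^ n) u = y ∧ ‖u‖ ≤ ε * ‖y‖)
    {z : X} (hz : T z = 0) : JSet T z = Set.univ := by
  refine Set.eq_univ_of_forall fun y => ?_
  have hex (n : ℕ) : ∃ m, n < m ∧ ∃ u, (T ^ m) u = y ∧ ‖u‖ ≤ 1 / ((n : ℝ) + 1) * ‖y‖ := by
    obtain ⟨m, hm, hnm⟩ :=
      ((hT (1 / ((n : ℝ) + 1)) (by positivity)).and (eventually_gt_atTop n)).exists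
    exact ⟨m, hnm, hm y⟩
  choose m hnm u hu hun using hex
  -- The exponents `m n > n` tend to infinity but need not increase.
  obtain ⟨φ, hφ, hmφ⟩ := strictMono_subseq_of_tendsto_atTop
    (tendsto_atTop_mono (fun n => (hnm n).le) tendsto_id)
  have hu0 : Tendsto u atTop (𝓝 0) := squeeze_zero_norm hun (by
    simpa using (tendsto_one_div_add_atTop_nhds_zero_nat (𝕜 := ℝ)).mul_const ‖y‖)
  refine ⟨m ∘ φ, hmφ, fun n => z + u (φ n), ?_, ?_⟩
  · simpa using (hu0.comp hφ.tendsto_atTop).const_add z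
  · refine tendsto_const_nhds.congr fun n => ?_
    obtain ⟨l, hl⟩ := Nat.exists_eq_succ_of_ne_zero (Nat.ne_of_gt (Nat.zero_lt_of_lt (hnm (φ n))))
    have : (T ^ m (φ n)) z = 0 := by
      rw [hl, Nat.succ_eq_add_one, pow_succ, mul_apply_eq_comp, hz, map_zero]
    rw [Function.comp_apply, map_add, this, zero_add, hu]

theorem corollary3p7 (T₁ T₂ : SeqLInf →L[ℂ] SeqLInf)
    (hadj₁ : IsAdjointOperator T₁) (hadj₂ : IsAdjointOperator T₂)
    (hcomm : T₁ ∘L T₂ = T₂ ∘L T₁)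
    (hJ₁ : IsJClass T₁) (hJ₂ : IsJClass T₂) :
    IsJClass (T₁ ∘L T₂) := by
  obtain ⟨z, hz0, hz⟩ := hadj₁.exists_ne_zero_map_eq_zero hJ₁
  refine ⟨z, hz0, jSet_eq_univ_of_map_eq_zero (fun ε hε => ?_)
    (by rw [hcomm, ContinuousLinearMap.comp_apply, hz, map_zero])⟩
  have hc : Commute T₁ T₂ := hcomm
  filter_upwards [hadj₁.eventually_exists_preimage hJ₁ hε,
    hadj₂.eventually_exists_preimage hJ₂ one_pos] with n h₁ h₂ y
  obtain ⟨v, hv, hvn⟩ := h₁ y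
  obtain ⟨u, hu, hun⟩ := h₂ v
  refine ⟨u, ?_, by linarith⟩
  change ((T₁ * T₂) ^ n) u = y
  rw [hc.mul_pow, mul_apply_eq_comp, hu, hv]
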